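/- There are absolute constants $\theta_0\in(0,1)$ and $C,c>0$ such that the following holds for all integers $n\ge 1$, $p\ge Cn$ and all $\theta\in(1/\sqrt n,\theta_0)$. Let $\mathbf x_0\in\mathbb R^p$ have entries distributed as $\frac{1}{\sqrt{\theta p}}\mathrm{Ber}(\theta)$ and let $\mathbf G\in\mathbb R^{p\times(n-1)}$ have $\mathcal N(0,1/p)$ entries, all these random variables being jointly independent. Let $$\mathbf Y=\Big[\tfrac{\mathbf x_0}{\|\mathbf x_0\|_2}\ \Big|\ \mathcal P_{\mathbf x_0^\perp}\mathbf G\,(\mathbf G^\top\mathcal P_{\mathbf x_0^\perp}\mathbf G)^{-1/2}\Big]\in\mathbb R^{p\times n}$$ be the canonical orthonormal basis of the span of $\mathbf x_0$ and the columns of $\mathbf G$. For a $p\times n$ matrix $\mathbf A$ and $\lambda>0$, the ADM iteration is $\mathbf q\mapsto \mathbf A^\top S_\lambda[\mathbf A\mathbf q]/\|\mathbf A^\top S_\lambda[\mathbf A\mathbf q]\|_2$, where $S_\lambda[t]=\mathrm{sign}(t)\max\{|t|-\lambda,0\}$ entrywise; its output $\overline{\mathbf q}$ is the point reached after some number $K\ge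 0$ of steps from some $\mathbf q^{(0)}\in\mathbb S^{n-1}$. With probability at least $1-cp^{-2}$, $\mathbf Y$ is well defined ($\mathbf x_0\ne\mathbf 0$ and $\mathbf G^\top\mathcal P_{\mathbf x_0^\perp}\mathbf G$ is positive definite) and both of the following hold, simultaneously for all $\lambda>0$, all $\mathbf q^{(0)}\in\mathbb S^{n-1}$ and all $K\ge 0$ (hence, taking $K=0$, for every $\overline{\mathbf q}\in\mathbb S^{n-1}$ as indicated): 1. Whenever the ADM output $\overline{\mathbf q}\in\mathbb S^{n-1}$ for the basis $\mathbf Y$ satisfies $|\overline q_1|>2\sqrt\theta$, the program $\min_{\mathbf q}\|\mathbf Y\mathbf q\|_1$ s.t. $\langle\overline{\mathbf q},\mathbf q\rangle=1$ has the unique optimal solution $\mathbf e_1/\overline q_1$, and $\mathbf Y(\mathbf e_1/\overline q_1)=\gamma\mathbf x_0$ for some $\gamma\neq0$. 2. For every orthogonal $\mathbf U\in\mathbb R^{n\times n}$, whenever the ADM output $\overline{\mathbf q}\in\mathbb S^{n-1}$ for the basis $\mathbf Y\mathbf U$ satisfies $|\langle\overline{\mathbf q},\mathbf U^\top\mathbf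 e_1\rangle|>2\sqrt\theta$, the program $\min_{\mathbf q}\|\mathbf Y\mathbf U\mathbf q\|_1$ s.t. $\langle\overline{\mathbf q},\mathbf q\rangle=1$ has the unique optimal solution $\mathbf U^\top\mathbf e_1/\langle\overline{\mathbf q},\mathbf U^\top\mathbf e_1\rangle$, which $\mathbf Y\mathbf U$ maps to $\gamma\mathbf x_0$ for some $\gamma\ne0$. -/

import Mathlib

open MeasureTheory ProbabilityTheory Matrix

noncomputable section

namespace PlantedSparse

/-- The law of `(1 / √(θ p)) · Ber(θ)`: the value `1 / √(θ p)` with probability `θ`,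
and `0` with probability `1 - θ`. -/
def scaledBernoulli (θ : ℝ) (p : ℕ) : Measure ℝ :=
  ENNReal.ofReal θ • Measure.dirac (1 / √(θ * p)) + ENNReal.ofReal (1 - θ) • Measure.dirac 0

/-- The planted sparse model: the entries of `x₀ ∈ ℝᵖ` have law `(1 / √(θ p)) Ber(θ)`, the entries
of the `p × d` matrix `G = [g₁ | ⋯ | g_d]` have law `N(0, 1/p)`, and all of these random variables
are jointly independent. -/
structure IsPlantedSparseModel {Ω : Type*} [MeasurableSpace Ω] {p d : ℕ} (θ : ℝ) (P : Measure Ω)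
    (x₀ : Ω → Fin p → ℝ) (G : Ω → Matrix (Fin p) (Fin d) ℝ) : Prop where
  law_x₀ : ∀ k, HasLaw (fun ω => x₀ ω k) (scaledBernoulli θ p) P
  law_G : ∀ k l, HasLaw (fun ω => G ω k l) (gaussianReal 0 (1 / (p : NNReal))) P
  indep : iIndepFun
    (Sum.elim (fun (k : Fin p) (ω : Ω) => x₀ ω k)
      (fun (kl : Fin p × Fin d) (ω : Ω) => G ω kl.1 kl.2)) P

variable {p d : ℕ}

/-- The orthogonal projection of `ℝᵖ` onto `x^⊥`, as a matrix. -/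
def projPerp (x : Fin p → ℝ) : Matrix (Fin p) (Fin p) ℝ :=
  1 - (x ⬝ᵥ x)⁻¹ • vecMulVec x x

/-- The matrix `Gᵀ P_{x^⊥} G`. -/
def gramPerp (x : Fin p → ℝ) (G : Matrix (Fin p) (Fin d) ℝ) : Matrix (Fin d) (Fin d) ℝ :=
  Gᵀ * projPerp x * G

/-- `A ^ (-1/2)` for a symmetric positive definite matrix `A`, by the functional calculus. -/
def invSqrt (A : Matrix (Fin d) (Fin d) ℝ) : Matrix (Fin d) (Fin d) ℝ :=
  cfc (fun t : ℝ => (√t)⁻¹) A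

/-- The canonical basis `[x / ‖x‖₂ | P_{x^⊥} G (Gᵀ P_{x^⊥} G)^{-1/2}]`, a `p × (d + 1)` matrix. -/
def canonicalBasis (x : Fin p → ℝ) (G : Matrix (Fin p) (Fin d) ℝ) :
    Matrix (Fin p) (Fin (d + 1)) ℝ :=
  Matrix.of fun i =>
    Fin.cons (x i / √(x ⬝ᵥ x)) ((projPerp x * G * invSqrt (gramPerp x G)) i)

/-- The canonical basis is well defined when `x ≠ 0` and `Gᵀ P_{x^⊥} G` is positive definite. -/
def CanonicalBasisWellDefined (x : Fin p → ℝ) (G : Matrix (Fin p) (Fin d) ℝ) : Prop :=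
  x ≠ 0 ∧ (gramPerp x G).PosDef

variable {n : ℕ}

/-- The `ℓ¹` norm of `Y q`. -/
def l1Obj (Y : Matrix (Fin p) (Fin n) ℝ) (q : EuclideanSpace ℝ (Fin n)) : ℝ :=
  ∑ i, |(Y *ᵥ q.ofLp) i|

/-- `q` is the unique optimal solution of the rounding program
`min ‖Y q‖₁` subject to `⟨r, q⟩ = 1`. -/
def IsUniqueRoundingSolution (Y : Matrix (Fin p) (Fin n) ℝ) (r q : EuclideanSpace ℝ (Fin n)) :
    Prop :=
  inner ℝ r q = 1 ∧ ∀ q', inner ℝ r q' = 1 → q' ≠ q → l1Obj Y q < l1Obj Y q'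

/-- The soft-thresholding operator. -/
def softThreshold (lam t : ℝ) : ℝ := Real.sign t * max (|t| - lam) 0

/-- One step of the alternating direction method: `x = S_λ[Y q]`, then `Yᵀ x / ‖Yᵀ x‖₂`
(which is `0`, hence not on the sphere, if `Yᵀ x = 0`). -/
def admStep (Y : Matrix (Fin p) (Fin n) ℝ) (lam : ℝ) (q : EuclideanSpace ℝ (Fin n)) :
    EuclideanSpace ℝ (Fin n) :=
  let v : EuclideanSpace ℝ (Fin n) :=
    WithLp.toLp 2 (Yᵀ *ᵥ fun i => softThreshold lam ((Y *ᵥ q.ofLp) i))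
  ‖v‖⁻¹ • v

/-- The output of the alternating direction method after `K` steps from `q₀`. -/
def admOutput (Y : Matrix (Fin p) (Fin n) ℝ) (lam : ℝ) (q₀ : EuclideanSpace ℝ (Fin n)) (K : ℕ) :
    EuclideanSpace ℝ (Fin n) :=
  (admStep Y lam)^[K] q₀

/-- The first standard basis vector of `ℝ^{d+1}`. -/
def e1 : EuclideanSpace ℝ (Fin (d + 1)) := EuclideanSpace.single 0 1

/-- Rounding of ADM outputs succeeds for the basis `Y` with target direction `v`: for every penalty
`λ > 0`, every initialization `q₀` on the sphere and every number `K` of steps, if the output `q̄`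
lies on the sphere and `|⟨q̄, v⟩| > 2√θ`, then `v / ⟨q̄, v⟩` is the unique solution of the rounding
program with `r = q̄`, and `Y` maps it to a nonzero multiple of `x`.
As `K = 0` is allowed, this covers every point `q̄` of the sphere with `|⟨q̄, v⟩| > 2√θ`. -/
def RoundingSucceeds (θ : ℝ) (x : Fin p → ℝ) (Y : Matrix (Fin p) (Fin n) ℝ)
    (v : EuclideanSpace ℝ (Fin n)) : Prop :=
  ∀ lam : ℝ, 0 < lam → ∀ q₀ : EuclideanSpace ℝ (Fin n), ‖q₀‖ = 1 → ∀ (K : ℕ),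
    ∀ qbar : EuclideanSpace ℝ (Fin n), qbar = admOutput Y lam q₀ K → ‖qbar‖ = 1 →
      2 * √θ < |inner ℝ qbar v| →
        IsUniqueRoundingSolution Y qbar ((inner ℝ qbar v)⁻¹ • v) ∧
        ∃ γ : ℝ, γ ≠ 0 ∧ Y *ᵥ ((inner ℝ qbar v)⁻¹ • v).ofLp = γ • x

end PlantedSparse

end

namespace PlantedSparse

/-- The range of `G` consists of vectors whose `ℓ¹` norm is comparable to `√p` times their `ℓ²`
norm, and `G` is injective. -/
def IsSpread {p d : ℕ} (β : ℝ) (G : Matrix (Fin p) (Fin d) ℝ) : Prop :=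
  ∀ h : Fin d → ℝ, h ≠ 0 → β * √p * √(∑ i, (G *ᵥ h) i ^ 2) < ∑ i, |(G *ᵥ h) i|

lemma projPerp_mulVec {p : ℕ} (x w : Fin p → ℝ) (i : Fin p) :
    (projPerp x *ᵥ w) i = w i - (x ⬝ᵥ x)⁻¹ * (x ⬝ᵥ w) * x i := by
  simp [projPerp, sub_mulVec, smul_mulVec, vecMulVec_mulVec]
  ring

lemma projPerp_transpose {p : ℕ} (x : Fin p → ℝ) : (projPerp x)ᵀ = projPerp x := by
  simp [projPerp, transpose_sub, transpose_smul, transpose_vecMulVec]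

lemma dotProduct_projPerp_mulVec {p : ℕ} {x : Fin p → ℝ} (hx : x ⬝ᵥ x ≠ 0) (w : Fin p → ℝ) :
    x ⬝ᵥ (projPerp x *ᵥ w) = 0 := by
  have : projPerp x *ᵥ w = w - ((x ⬝ᵥ x)⁻¹ * (x ⬝ᵥ w)) • x := by
    ext i; simp [projPerp_mulVec]
  rw [this, dotProduct_sub, dotProduct_smul, smul_eq_mul]
  field_simp
  ring

lemma projPerp_mul_self {p : ℕ} {x : Fin p → ℝ} (hx : x ⬝ᵥ x ≠ 0) :
    projPerp x * projPerp x = projPerp x := by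
  refine Matrix.ext_of_mulVec_single fun j => ?_
  rw [← mulVec_mulVec]
  ext i
  rw [projPerp_mulVec x (projPerp x *ᵥ _), dotProduct_projPerp_mulVec hx]
  simp

lemma dotProduct_gramPerp {p d : ℕ} {x : Fin p → ℝ} (hx : x ⬝ᵥ x ≠ 0)
    (G : Matrix (Fin p) (Fin d) ℝ) (u : Fin d → ℝ) :
    u ⬝ᵥ (gramPerp x G *ᵥ u) = ∑ i, (projPerp x *ᵥ (G *ᵥ u)) i ^ 2 := by
  have : gramPerp x G = (projPerp x * G)ᵀ * (projPerp x * G) := by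
    rw [gramPerp, transpose_mul, projPerp_transpose, Matrix.mul_assoc,
      Matrix.mul_assoc Gᵀ, ← Matrix.mul_assoc (projPerp x) (projPerp x), projPerp_mul_self hx]
  rw [this, ← mulVec_mulVec, dotProduct_mulVec, vecMul_transpose, ← mulVec_mulVec, dotProduct]
  exact Finset.sum_congr rfl fun i _ => by ring

lemma sum_sq_projPerp_le {p : ℕ} {x : Fin p → ℝ} (hx : x ⬝ᵥ x ≠ 0) (w : Fin p → ℝ) :
    ∑ i, (projPerp x *ᵥ w) i ^ 2 ≤ ∑ i, w i ^ 2 := by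
  have h0 : 0 ≤ x ⬝ᵥ x := Finset.sum_nonneg fun i _ => mul_self_nonneg (x i)
  have h1 := dotProduct_projPerp_mulVec hx w
  have h2 : ∑ i, w i ^ 2 = ∑ i, (projPerp x *ᵥ w) i ^ 2
      + 2 * ((x ⬝ᵥ x)⁻¹ * (x ⬝ᵥ w)) * (x ⬝ᵥ (projPerp x *ᵥ w))
      + ((x ⬝ᵥ x)⁻¹ * (x ⬝ᵥ w)) ^ 2 * (x ⬝ᵥ x) := by
    have e : ∀ i, w i = (projPerp x *ᵥ w) i + ((x ⬝ᵥ x)⁻¹ * (x ⬝ᵥ w)) * x i := fun i => by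
      rw [projPerp_mulVec]; ring
    generalize (x ⬝ᵥ x)⁻¹ * (x ⬝ᵥ w) = c at e
    generalize projPerp x *ᵥ w = g at e
    simp only [dotProduct, Finset.mul_sum, ← Finset.sum_add_distrib]
    exact Finset.sum_congr rfl fun i _ => by rw [e i]; ring
  rw [h2, h1]
  have : 0 ≤ ((x ⬝ᵥ x)⁻¹ * (x ⬝ᵥ w)) ^ 2 * (x ⬝ᵥ x) := by positivity
  linarith

lemma invSqrt_isSymm {d : ℕ} (A : Matrix (Fin d) (Fin d) ℝ) : (invSqrt A)ᵀ = invSqrt A := by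
  have h : IsSelfAdjoint (invSqrt A) := cfc_predicate _ _
  simpa [IsSelfAdjoint, star_eq_conjTranspose, conjTranspose_eq_transpose_of_trivial] using h

lemma invSqrt_mul_mul_invSqrt {d : ℕ} {A : Matrix (Fin d) (Fin d) ℝ} (hA : A.PosDef) :
    invSqrt A * A * invSqrt A = 1 := by
  have hs : IsSelfAdjoint A := hA.isHermitian
  have hpos : ∀ t ∈ spectrum ℝ A, 0 < t := by
    intro t ht
    rw [hA.isHermitian.spectrum_real_eq_range_eigenvalues] at ht
    obtain ⟨i, rfl⟩ := ht
    exact hA.eigenvalues_pos i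
  have hc : ContinuousOn (fun t : ℝ => (√t)⁻¹) (spectrum ℝ A) :=
    ContinuousOn.inv₀ Real.continuous_sqrt.continuousOn
      fun t ht => (Real.sqrt_pos.2 (hpos t ht)).ne'
  have h1 : invSqrt A * A = cfc (fun t : ℝ => (√t)⁻¹ * t) A := by
    conv_lhs => rw [invSqrt]; enter [2]; rw [← cfc_id ℝ A]
    rw [← cfc_mul _ _ A hc continuousOn_id]
    rfl
  rw [h1, invSqrt, ← cfc_mul (fun t : ℝ => (√t)⁻¹ * t) _ A (hc.mul continuousOn_id) hc]
  rw [← cfc_one ℝ A]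
  refine cfc_congr fun t ht => ?_
  have h2 := Real.sqrt_pos.2 (hpos t ht)
  have h3 := Real.mul_self_sqrt (hpos t ht).le
  simp only [Pi.one_apply]
  field_simp
  nlinarith

/-- The canonical basis has orthonormal last columns. -/
lemma sum_sq_projPerp_invSqrt {p d : ℕ} {x : Fin p → ℝ} (hx : x ⬝ᵥ x ≠ 0)
    {G : Matrix (Fin p) (Fin d) ℝ} (hG : (gramPerp x G).PosDef) (h : Fin d → ℝ) :
    ∑ i, (projPerp x *ᵥ (G *ᵥ (invSqrt (gramPerp x G) *ᵥ h))) i ^ 2 = ∑ l, h l ^ 2 := by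
  rw [← dotProduct_gramPerp hx, mulVec_mulVec, dotProduct_mulVec, vecMul_mulVec,
    invSqrt_isSymm, ← Matrix.mul_assoc, invSqrt_mul_mul_invSqrt hG]
  simp [dotProduct, sq]

lemma canonicalBasis_mulVec {p d : ℕ} (x : Fin p → ℝ) (G : Matrix (Fin p) (Fin d) ℝ)
    (q : Fin (d + 1) → ℝ) (i : Fin p) :
    (canonicalBasis x G *ᵥ q) i = q 0 * (x i / √(x ⬝ᵥ x)) +
      (projPerp x *ᵥ (G *ᵥ (invSqrt (gramPerp x G) *ᵥ Fin.tail q))) i := by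
  rw [mulVec_mulVec, mulVec_mulVec]
  simp only [mulVec, canonicalBasis, dotProduct, Fin.sum_univ_succ, Matrix.of_apply, Fin.cons_zero,
    Fin.cons_succ, Fin.tail]
  ring

section TwoValued

variable {p : ℕ} {x : Fin p → ℝ} {τ : ℝ} {I : Finset (Fin p)}

lemma two_valued_dotProduct (hx : ∀ i, x i = if i ∈ I then τ else 0) (w : Fin p → ℝ) :
    x ⬝ᵥ w = τ * ∑ i ∈ I, w i := by
  simp [dotProduct, hx, Finset.mul_sum, ite_mul]

lemma two_valued_dotProduct_self (hx : ∀ i, x i = if i ∈ I then τ else 0) :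
    x ⬝ᵥ x = τ ^ 2 * I.card := by
  rw [two_valued_dotProduct hx, Finset.sum_congr rfl (g := fun _ => τ) fun i hi => by simp [hx, hi]]
  simp; ring

lemma two_valued_projPerp_of_notMem (hx : ∀ i, x i = if i ∈ I then τ else 0) (w : Fin p → ℝ)
    {i : Fin p} (hi : i ∉ I) : (projPerp x *ᵥ w) i = w i := by
  simp [projPerp_mulVec, hx, hi]

lemma two_valued_sum_abs_projPerp_le (hτ : 0 < τ) (hI : 0 < I.card)
    (hx : ∀ i, x i = if i ∈ I then τ else 0) (w : Fin p → ℝ) :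
    ∑ i ∈ I, |(projPerp x *ᵥ w) i| ≤ 2 * ∑ i ∈ I, |w i| := by
  have hI' : (0 : ℝ) < I.card := by exact_mod_cast hI
  have h1 : ∀ i ∈ I, |(projPerp x *ᵥ w) i| ≤ |w i| + (I.card : ℝ)⁻¹ * ∑ j ∈ I, |w j| := by
    intro i hi
    rw [projPerp_mulVec, two_valued_dotProduct_self hx, two_valued_dotProduct hx, hx i, if_pos hi]
    have e : (τ ^ 2 * (I.card : ℝ))⁻¹ * (τ * ∑ i ∈ I, w i) * τ
        = (I.card : ℝ)⁻¹ * ∑ i ∈ I, w i := by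
      field_simp
    rw [e]
    refine (abs_sub _ _).trans ?_
    rw [abs_mul, abs_of_pos (inv_pos.2 hI')]
    gcongr
    exact Finset.abs_sum_le_sum_abs _ _
  refine (Finset.sum_le_sum h1).trans ?_
  rw [Finset.sum_add_distrib, Finset.sum_const, nsmul_eq_mul, ← mul_assoc,
    mul_inv_cancel₀ hI'.ne']
  linarith

lemma sum_abs_le_sqrt_card_mul (I : Finset (Fin p)) (w : Fin p → ℝ) :
    ∑ i ∈ I, |w i| ≤ √I.card * √(∑ i, w i ^ 2) := by
  have h := Real.sum_mul_le_sqrt_mul_sqrt I (fun _ => (1 : ℝ)) (fun i => |w i|)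
  simp only [one_mul, one_pow, Finset.sum_const, nsmul_eq_mul, mul_one, sq_abs] at h
  refine h.trans ?_
  gcongr
  exact Finset.subset_univ I

/-- The nullspace-type inequality: projecting a spread vector away from a two-valued vector with
small support `I` keeps most of its `ℓ¹` mass off `I`. -/
lemma two_valued_off_support (hτ : 0 < τ) (hI : 0 < I.card)
    (hx : ∀ i, x i = if i ∈ I then τ else 0) (w : Fin p → ℝ) :
    ∑ i, |w i| - 3 * (√I.card * √(∑ i, w i ^ 2)) ≤
      ∑ i ∈ Iᶜ, |(projPerp x *ᵥ w) i| - ∑ i ∈ I, |(projPerp x *ᵥ w) i| := by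
  have h1 := two_valued_sum_abs_projPerp_le hτ hI hx w
  have h2 := sum_abs_le_sqrt_card_mul I w
  have h3 : ∑ i ∈ Iᶜ, |(projPerp x *ᵥ w) i| = ∑ i ∈ Iᶜ, |w i| :=
    Finset.sum_congr rfl fun i hi => by
      rw [two_valued_projPerp_of_notMem hx w (Finset.mem_compl.1 hi)]
  have h4 := Finset.sum_add_sum_compl I fun i => |w i|
  rw [h3]
  linarith

end TwoValued

/-- If the support is small and `G` is spread, the canonical basis is well defined. -/
lemma canonicalBasisWellDefined_of_isSpread {p d : ℕ} {x : Fin p → ℝ} {τ β : ℝ}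
    {I : Finset (Fin p)} {G : Matrix (Fin p) (Fin d) ℝ} (hτ : 0 < τ) (hI : 0 < I.card)
    (hx : ∀ i, x i = if i ∈ I then τ else 0) (hβ : 3 * √I.card ≤ β * √p) (hG : IsSpread β G) :
    CanonicalBasisWellDefined x G := by
  have hI' : (0 : ℝ) < I.card := by exact_mod_cast hI
  have hxx : x ⬝ᵥ x ≠ 0 := by
    rw [two_valued_dotProduct_self hx]; positivity
  refine ⟨fun h => hxx (by simp [h]), ?_⟩
  refine Matrix.PosDef.of_dotProduct_mulVec_pos ?_ fun u hu => ?_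
  · rw [Matrix.IsHermitian, conjTranspose_eq_transpose_of_trivial, gramPerp, transpose_mul,
      transpose_mul, transpose_transpose, projPerp_transpose, Matrix.mul_assoc]
  · rw [star_trivial, dotProduct_gramPerp hxx]
    refine lt_of_le_of_ne (Finset.sum_nonneg fun i _ => sq_nonneg _) fun h0 => ?_
    have hz : ∀ i, (projPerp x *ᵥ (G *ᵥ u)) i = 0 := fun i => by
      have := (Finset.sum_eq_zero_iff_of_nonneg fun i _ => sq_nonneg _).1 h0.symm i
        (Finset.mem_univ i)
      exact pow_eq_zero_iff two_ne_zero |>.1 this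
    have h1 := two_valued_off_support hτ hI hx (G *ᵥ u)
    simp only [hz, abs_zero, Finset.sum_const_zero, sub_zero] at h1
    have h2 := hG u hu
    have h3 := mul_le_mul_of_nonneg_right hβ (Real.sqrt_nonneg (∑ i, (G *ᵥ u) i ^ 2))
    linarith

lemma sum_abs_add_ge {p : ℕ} (I : Finset (Fin p)) (a : ℝ) (b g : Fin p → ℝ)
    (hb : ∀ i, i ∉ I → b i = 0) :
    |a| * ∑ i ∈ I, |b i| + (∑ i ∈ Iᶜ, |g i| - ∑ i ∈ I, |g i|) ≤ ∑ i, |a * b i + g i| := by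
  rw [← Finset.sum_add_sum_compl I fun i => |a * b i + g i|]
  have h1 : ∑ i ∈ Iᶜ, |a * b i + g i| = ∑ i ∈ Iᶜ, |g i| :=
    Finset.sum_congr rfl fun i hi => by rw [hb i (Finset.mem_compl.1 hi)]; simp
  have h2 : ∑ i ∈ I, (|a| * |b i| - |g i|) ≤ ∑ i ∈ I, |a * b i + g i| := by
    refine Finset.sum_le_sum fun i _ => ?_
    rw [← abs_mul]
    have := abs_sub_abs_le_abs_sub (a * b i) (-(g i))
    rwa [abs_neg, sub_neg_eq_add] at this
  rw [Finset.sum_sub_distrib, ← Finset.mul_sum] at h2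
  rw [h1]
  linarith

lemma inner_eq_zero_add_tail {d : ℕ} (r q : EuclideanSpace ℝ (Fin (d + 1))) :
    inner ℝ r q = r 0 * q 0 + ∑ l : Fin d, r l.succ * q l.succ := by
  simp [PiLp.inner_apply, Fin.sum_univ_succ, mul_comm]

/-- Rounding succeeds at every point of the sphere that is correlated with `e₁`. -/
theorem l1Obj_lt_of_isSpread {p d : ℕ} {x : Fin p → ℝ} {τ β θ : ℝ}
    {I : Finset (Fin p)} {G : Matrix (Fin p) (Fin d) ℝ} (hτ : 0 < τ) (hI : 0 < I.card)
    (hx : ∀ i, x i = if i ∈ I then τ else 0) (hθ : 0 < θ)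
    (hβ : √I.card * (3 + 1 / (2 * √θ)) ≤ β * √p) (hG : IsSpread β G)
    (hGd : (gramPerp x G).PosDef)
    {r : EuclideanSpace ℝ (Fin (d + 1))} (hr : ‖r‖ = 1) (hr0 : 2 * √θ < |r 0|)
    {q : EuclideanSpace ℝ (Fin (d + 1))} (hq : inner ℝ r q = 1)
    (hne : q ≠ (r 0)⁻¹ • (e1 : EuclideanSpace ℝ (Fin (d + 1)))) :
    l1Obj (canonicalBasis x G) ((r 0)⁻¹ • (e1 : EuclideanSpace ℝ (Fin (d + 1))))
      < l1Obj (canonicalBasis x G) q := by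
  have hI' : (0 : ℝ) < I.card := by exact_mod_cast hI
  have hxx : x ⬝ᵥ x ≠ 0 := by
    rw [two_valued_dotProduct_self hx]; positivity
  have hθ' : 0 < √θ := Real.sqrt_pos.2 hθ
  have hr0' : 0 < |r 0| := by linarith
  have hr0n : r 0 ≠ 0 := abs_pos.1 hr0'
  set h : Fin d → ℝ := Fin.tail q.ofLp with hh
  set w := G *ᵥ (invSqrt (gramPerp x G) *ᵥ h) with hw
  set g := projPerp x *ᵥ w with hg
  set b : Fin p → ℝ := fun i => x i / √(x ⬝ᵥ x) with hb
  have hsq : √(x ⬝ᵥ x) = τ * √I.card := by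
    rw [two_valued_dotProduct_self hx, Real.sqrt_mul (sq_nonneg _), Real.sqrt_sq hτ.le]
  have hbI : ∑ i ∈ I, |b i| = √I.card := by
    have : ∀ i ∈ I, |b i| = 1 / √I.card := fun i hi => by
      simp only [hb, hsq, hx i, if_pos hi]
      rw [abs_of_pos (by positivity)]
      field_simp
    rw [Finset.sum_congr rfl this, Finset.sum_const, nsmul_eq_mul]
    rw [mul_one_div, Real.div_sqrt]
  have hball : ∑ i, |b i| = √I.card := by
    rw [← hbI]
    refine (Finset.sum_subset (Finset.subset_univ I) fun i _ hi => ?_).symm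
    simp [hb, hx i, hi]
  have hsol : l1Obj (canonicalBasis x G) ((r 0)⁻¹ • (e1 : EuclideanSpace ℝ (Fin (d + 1))))
      = |r 0|⁻¹ * √I.card := by
    have ht : Fin.tail (((r 0)⁻¹ • (e1 : EuclideanSpace ℝ (Fin (d + 1)))).ofLp) = 0 := by
      ext l; simp [Fin.tail, e1]
    have h0 : ((r 0)⁻¹ • (e1 : EuclideanSpace ℝ (Fin (d + 1)))).ofLp 0 = (r 0)⁻¹ := by
      simp [e1]
    simp only [l1Obj, canonicalBasis_mulVec, ht, h0, mulVec_zero, Pi.zero_apply, add_zero, abs_mul,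
      ← Finset.mul_sum, abs_inv]
    rw [← hball]
  have hobj : l1Obj (canonicalBasis x G) q = ∑ i, |q 0 * b i + g i| := by
    simp only [l1Obj, canonicalBasis_mulVec]
    rfl
  have hn : h ≠ 0 := by
    intro hz
    apply hne
    have hz' : ∀ l : Fin d, q l.succ = 0 := fun l => congrFun hz l
    rw [inner_eq_zero_add_tail] at hq
    simp only [hz', mul_zero, Finset.sum_const_zero, add_zero] at hq
    ext j
    refine Fin.cases ?_ (fun l => ?_) j
    · simp only [PiLp.smul_apply, e1, PiLp.single_apply, if_true, smul_eq_mul, mul_one]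
      field_simp
      linarith
    · simp [hz', e1]
  have hnorm : ∑ i, g i ^ 2 = ∑ l, h l ^ 2 := sum_sq_projPerp_invSqrt hxx hGd h
  have hun : invSqrt (gramPerp x G) *ᵥ h ≠ 0 := by
    intro hu
    have hg0 : g = 0 := by rw [hg, hw, hu]; simp
    rw [hg0] at hnorm
    simp only [Pi.zero_apply, ne_eq, OfNat.ofNat_ne_zero, not_false_eq_true, zero_pow,
      Finset.sum_const_zero] at hnorm
    apply hn
    ext l
    exact pow_eq_zero_iff two_ne_zero |>.1 <|
      (Finset.sum_eq_zero_iff_of_nonneg fun i _ => sq_nonneg _).1 hnorm.symm l (Finset.mem_univ l)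
  have hsp := hG _ hun
  have hoff := two_valued_off_support hτ hI hx w
  have hlow := sum_abs_add_ge I (q 0) b g fun i hi => by simp [hb, hx i, hi]
  have hgw : √(∑ l, h l ^ 2) ≤ √(∑ i, w i ^ 2) := by
    rw [← hnorm]
    exact Real.sqrt_le_sqrt (sum_sq_projPerp_le hxx w)
  have hcs : |∑ l : Fin d, r l.succ * q l.succ| ≤ √(∑ l, h l ^ 2) := by
    rw [← Real.sqrt_sq_eq_abs]
    refine Real.sqrt_le_sqrt ((Finset.sum_mul_sq_le_sq_mul_sq _ _ _).trans ?_)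
    have h1 : ∑ l : Fin d, r l.succ ^ 2 ≤ 1 := by
      have := EuclideanSpace.real_norm_sq_eq r
      rw [hr, Fin.sum_univ_succ] at this
      nlinarith [sq_nonneg (r 0)]
    have h2 : 0 ≤ ∑ l : Fin d, q l.succ ^ 2 := Finset.sum_nonneg fun _ _ => sq_nonneg _
    calc _ ≤ 1 * ∑ l : Fin d, q l.succ ^ 2 := by gcongr
      _ = _ := one_mul _
  have hq0 : |r 0|⁻¹ - |r 0|⁻¹ * √(∑ l, h l ^ 2) ≤ |q 0| := by
    rw [inner_eq_zero_add_tail] at hq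
    have h1 : 1 - √(∑ l, h l ^ 2) ≤ |r 0| * |q 0| := by
      rw [← abs_mul]
      have := le_abs_self (r 0 * q 0)
      have := le_abs_self (∑ l : Fin d, r l.succ * q l.succ)
      linarith
    have h2 := mul_le_mul_of_nonneg_left h1 (inv_pos.2 hr0').le
    rw [← mul_assoc, inv_mul_cancel₀ hr0'.ne'] at h2
    linarith
  have hinv : |r 0|⁻¹ ≤ 1 / (2 * √θ) := by
    rw [one_div]; exact inv_anti₀ (by positivity) hr0.le
  rw [hsol, hobj]
  refine lt_of_lt_of_le ?_ hlow
  rw [hbI]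
  have hW := Real.sqrt_nonneg (∑ i, w i ^ 2)
  have hN := Real.sqrt_nonneg (I.card : ℝ)
  have e1 := mul_le_mul_of_nonneg_right hq0 hN
  have e2 : |r 0|⁻¹ * √(∑ l, h l ^ 2) ≤ 1 / (2 * √θ) * √(∑ i, w i ^ 2) :=
    mul_le_mul hinv hgw (Real.sqrt_nonneg _) (by positivity)
  have e3 := mul_le_mul_of_nonneg_right e2 hN
  have e4 := mul_le_mul_of_nonneg_right hβ hW
  nlinarith

/-- Volumetric bound: a `δ`-separated subset of the unit ball has at most `(1 + 2 / δ) ^ dim`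
points. -/
lemma card_le_of_separated_unitBall {E : Type*} [NormedAddCommGroup E] [NormedSpace ℝ E]
    [FiniteDimensional ℝ E] {δ : ℝ} (hδ : 0 < δ) (s : Finset E) (hs : ∀ c ∈ s, ‖c‖ ≤ 1)
    (h : ∀ c ∈ s, ∀ c' ∈ s, c ≠ c' → δ ≤ ‖c - c'‖) :
    (s.card : ℝ) ≤ (1 + 2 / δ) ^ Module.finrank ℝ E := by
  borelize E
  let μ : Measure E := Measure.addHaar
  have hδ2 : 0 < δ / 2 := by positivity
  have hρ : 0 < 1 + δ / 2 := by positivity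
  have hdisj : Set.Pairwise (s : Set E)
      (Function.onFun Disjoint fun c => Metric.ball (c : E) (δ / 2)) := by
    intro c hc c' hc' hcc
    apply Metric.ball_disjoint_ball
    rw [dist_eq_norm, add_halves]
    exact h c hc c' hc' hcc
  have hsub : (⋃ c ∈ s, Metric.ball (c : E) (δ / 2)) ⊆ Metric.ball (0 : E) (1 + δ / 2) := by
    refine Set.iUnion₂_subset fun c hc => Metric.ball_subset_ball' ?_
    rw [dist_zero_right]
    linarith [hs c hc]
  have hvol : (s.card : ENNReal) * ENNReal.ofReal ((δ / 2) ^ Module.finrank ℝ E) *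
      μ (Metric.ball 0 1) ≤
      ENNReal.ofReal ((1 + δ / 2) ^ Module.finrank ℝ E) * μ (Metric.ball 0 1) := by
    calc _ = μ (⋃ c ∈ s, Metric.ball (c : E) (δ / 2)) := by
          rw [measure_biUnion_finset hdisj fun c _ => measurableSet_ball]
          simp only [μ.addHaar_ball_of_pos _ hδ2, Finset.sum_const, nsmul_eq_mul, mul_assoc]
      _ ≤ μ (Metric.ball (0 : E) (1 + δ / 2)) := measure_mono hsub
      _ = _ := μ.addHaar_ball_of_pos _ hρ
  have hle := (ENNReal.mul_le_mul_iff_left (Metric.measure_ball_pos _ _ zero_lt_one).ne'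
    measure_ball_lt_top.ne).1 hvol
  have hreal := ENNReal.toReal_le_of_le_ofReal (pow_nonneg hρ.le _) hle
  rw [ENNReal.toReal_mul, ENNReal.toReal_natCast, ENNReal.toReal_ofReal (by positivity),
    ← le_div_iff₀ (by positivity), ← div_pow] at hreal
  refine hreal.trans_eq ?_
  congr 1
  field_simp
  ring

/-- The unit sphere has a `δ`-net with at most `(1 + 2 / δ) ^ dim` points. -/
lemma exists_net_sphere {E : Type*} [NormedAddCommGroup E] [NormedSpace ℝ E]
    [FiniteDimensional ℝ E] {δ : ℝ} (hδ : 0 < δ) :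
    ∃ s : Finset E, (∀ c ∈ s, ‖c‖ = 1) ∧ (∀ v : E, ‖v‖ = 1 → ∃ c ∈ s, ‖v - c‖ ≤ δ) ∧
      (s.card : ℝ) ≤ (1 + 2 / δ) ^ Module.finrank ℝ E := by
  classical
  let Q : Finset E → Prop := fun s =>
    (∀ c ∈ s, ‖c‖ = 1) ∧ ∀ c ∈ s, ∀ c' ∈ s, c ≠ c' → δ ≤ ‖c - c'‖
  have hbound : ∀ s, Q s → s.card ≤ ⌊(1 + 2 / δ) ^ Module.finrank ℝ E⌋₊ := fun s hs =>
    Nat.le_floor (card_le_of_separated_unitBall hδ s (fun c hc => (hs.1 c hc).le) hs.2)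
  let N : Set ℕ := {k | ∃ s, Q s ∧ s.card = k}
  have hne : N.Nonempty := ⟨0, ∅, ⟨by simp, by simp⟩, rfl⟩
  have hbdd : BddAbove N := ⟨_, by rintro k ⟨s, hs, rfl⟩; exact hbound s hs⟩
  obtain ⟨s, hs, hcard⟩ := Nat.sSup_mem hne hbdd
  refine ⟨s, hs.1, fun v hv => ?_, card_le_of_separated_unitBall hδ s (fun c hc => (hs.1 c hc).le)
    hs.2⟩
  by_contra! hfar
  have hvs : v ∉ s := fun hvs => by
    have := hfar v hvs
    simp only [sub_self, norm_zero] at this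
    linarith
  have hQ : Q (insert v s) := by
    refine ⟨fun c hc => ?_, fun c hc c' hc' hcc => ?_⟩
    · rcases Finset.mem_insert.1 hc with rfl | hc
      exacts [hv, hs.1 c hc]
    · rcases Finset.mem_insert.1 hc with rfl | h₁ <;> rcases Finset.mem_insert.1 hc' with rfl | h₂
      · exact absurd rfl hcc
      · exact (hfar c' h₂).le
      · rw [norm_sub_rev]; exact (hfar c h₁).le
      · exact hs.2 c h₁ c' h₂ hcc
  have := le_csSup hbdd (show (insert v s).card ∈ N from ⟨_, hQ, rfl⟩)
  rw [Finset.card_insert_of_notMem hvs, ← hcard] at this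
  omega

lemma sum_abs_le_sqrt_mul_norm {p : ℕ} (w : EuclideanSpace ℝ (Fin p)) :
    ∑ i, |w i| ≤ √p * ‖w‖ := by
  have := sum_abs_le_sqrt_card_mul Finset.univ w.ofLp
  simpa [EuclideanSpace.norm_eq] using this

/-- If `‖G c‖₂ ≤ 1.1` and `‖G c‖₁ > 0.7 √p` on a `1/20`-net of the sphere, then `G` is spread. -/
lemma isSpread_of_net {p d : ℕ} (G : Matrix (Fin p) (Fin d) ℝ)
    (s : Finset (EuclideanSpace ℝ (Fin d)))
    (hs : ∀ v : EuclideanSpace ℝ (Fin d), ‖v‖ = 1 → ∃ c ∈ s, ‖v - c‖ ≤ 1 / 20)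
    (h2 : ∀ c ∈ s, ∑ i, (G *ᵥ c.ofLp) i ^ 2 ≤ 1.21)
    (h1 : ∀ c ∈ s, 0.7 * √p < ∑ i, |(G *ᵥ c.ofLp) i|) : IsSpread 0.55 G := by
  let A : EuclideanSpace ℝ (Fin d) →L[ℝ] EuclideanSpace ℝ (Fin p) :=
    (Matrix.toEuclideanLin G).toContinuousLinearMap
  have hA : ∀ v i, A v i = (G *ᵥ v.ofLp) i := fun v i => rfl
  have hAc : ∀ c ∈ s, ‖A c‖ ≤ 1.1 := fun c hc => by
    rw [EuclideanSpace.norm_eq]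
    refine Real.sqrt_le_iff.2 ⟨by norm_num, ?_⟩
    simp only [Real.norm_eq_abs, sq_abs, hA]
    exact (h2 c hc).trans (by norm_num)
  have hunit : ∀ v : EuclideanSpace ℝ (Fin d), v ≠ 0 → ‖‖v‖⁻¹ • v‖ = 1 := fun v hv => by
    rw [norm_smul, norm_inv, norm_norm, inv_mul_cancel₀ (norm_ne_zero_iff.2 hv)]
  have hsph : ∀ v, ‖v‖ = 1 → ‖A v‖ ≤ 1.1 + 1 / 20 * ‖A‖ := by
    intro v hv
    obtain ⟨c, hc, hvc⟩ := hs v hv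
    have : A v = A c + A (v - c) := by rw [← map_add]; simp
    rw [this]
    refine (norm_add_le _ _).trans (add_le_add (hAc c hc) ?_)
    rw [mul_comm]
    exact (A.le_opNorm _).trans (by gcongr)
  have hop : ‖A‖ ≤ 1.1 + 1 / 20 * ‖A‖ := by
    refine A.opNorm_le_bound (by positivity) fun v => ?_
    by_cases hv : v = 0
    · simp [hv]
    · have := hsph _ (hunit v hv)
      rw [map_smul, norm_smul, norm_inv, norm_norm] at this
      rwa [inv_mul_le_iff₀ (norm_pos_iff.2 hv), mul_comm] at this
  have hmain : ∀ v, ‖v‖ = 1 → 0.55 * √p * ‖A v‖ < ∑ i, |A v i| := by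
    intro v hv
    obtain ⟨c, hc, hvc⟩ := hs v hv
    have e1 : ∑ i, |A c i| ≤ ∑ i, |A v i| + ∑ i, |A (v - c) i| := by
      rw [← Finset.sum_add_distrib]
      refine Finset.sum_le_sum fun i _ => ?_
      have : A c i = A v i - A (v - c) i := by simp
      rw [this]
      exact abs_sub _ _
    have e2 := sum_abs_le_sqrt_mul_norm (A (v - c))
    have e3 : ‖A (v - c)‖ ≤ ‖A‖ * (1 / 20) := (A.le_opNorm _).trans (by gcongr)
    have e4 := h1 c hc
    have e5 : ‖A v‖ ≤ ‖A‖ := by simpa [hv] using A.le_opNorm v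
    have hp := Real.sqrt_nonneg (p : ℝ)
    have e6 : ‖A‖ ≤ 1.16 := by norm_num at hop ⊢; linarith
    have e7 := mul_le_mul_of_nonneg_left (e3.trans (show ‖A‖ * (1 / 20) ≤ 0.058 by
      norm_num at e6 ⊢; linarith)) hp
    have e8 := mul_le_mul_of_nonneg_left (e5.trans e6) hp
    simp only [hA] at e1 e2 ⊢
    norm_num at e4 e7 e8 ⊢
    nlinarith
  intro h hh
  have hv : (WithLp.toLp 2 h : EuclideanSpace ℝ (Fin d)) ≠ 0 := fun h0 => hh (by
    have := congrArg WithLp.ofLp h0; simpa using this)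
  have hk := hmain _ (hunit _ hv)
  have hpos := norm_pos_iff.2 hv
  simp only [map_smul, norm_smul, norm_inv, norm_norm, PiLp.smul_apply, smul_eq_mul, abs_mul,
    abs_inv, abs_norm, ← Finset.mul_sum] at hk
  rw [mul_left_comm, mul_lt_mul_iff_right₀ (inv_pos.2 hpos), EuclideanSpace.norm_eq] at hk
  simpa only [hA, Real.norm_eq_abs, sq_abs] using hk

section Chernoff

variable {Ω : Type*} [MeasurableSpace Ω] {P : Measure Ω} {ι : Type*} [Fintype ι]
  {X : ι → Ω → ℝ} {t : ℝ}

lemma integrable_exp_mul_sum_of_iIndepFun (hX : iIndepFun X P) (hm : ∀ i, AEMeasurable (X i) P)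
    (hint : ∀ i, Integrable (fun ω => Real.exp (t * X i ω)) P) :
    Integrable (fun ω => Real.exp (t * (∑ i, X i) ω)) P := by
  have := hX.isProbabilityMeasure
  rw [← mgf_pos_iff, hX.mgf_sum₀ hm]
  exact Finset.prod_pos fun i _ => mgf_pos (hint i)

lemma mgf_sum_le_pow (hX : iIndepFun X P) (hm : ∀ i, AEMeasurable (X i) P) {m : ℝ}
    (hmgf : ∀ i, mgf (X i) P t ≤ m) : mgf (∑ i, X i) P t ≤ m ^ Fintype.card ι := by
  rw [hX.mgf_sum₀ hm, ← Finset.card_univ, ← Finset.prod_const]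
  exact Finset.prod_le_prod (fun i _ => mgf_nonneg) fun i _ => hmgf i

lemma chernoff_ge (hX : iIndepFun X P) (hm : ∀ i, AEMeasurable (X i) P) (ht : 0 ≤ t)
    (hint : ∀ i, Integrable (fun ω => Real.exp (t * X i ω)) P) {m : ℝ}
    (hmgf : ∀ i, mgf (X i) P t ≤ m) (a : ℝ) :
    P.real {ω | a ≤ ∑ i, X i ω} ≤ Real.exp (-t * a) * m ^ Fintype.card ι := by
  have := hX.isProbabilityMeasure
  have h := measure_ge_le_exp_mul_mgf a ht (integrable_exp_mul_sum_of_iIndepFun hX hm hint)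
  simp only [Finset.sum_apply] at h
  exact h.trans (by gcongr; exact mgf_sum_le_pow hX hm hmgf)

lemma chernoff_le (hX : iIndepFun X P) (hm : ∀ i, AEMeasurable (X i) P) (ht : t ≤ 0)
    (hint : ∀ i, Integrable (fun ω => Real.exp (t * X i ω)) P) {m : ℝ}
    (hmgf : ∀ i, mgf (X i) P t ≤ m) (a : ℝ) :
    P.real {ω | ∑ i, X i ω ≤ a} ≤ Real.exp (-t * a) * m ^ Fintype.card ι := by
  have := hX.isProbabilityMeasure
  have h := measure_le_le_exp_mul_mgf a ht (integrable_exp_mul_sum_of_iIndepFun hX hm hint)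
  simp only [Finset.sum_apply] at h
  exact h.trans (by gcongr; exact mgf_sum_le_pow hX hm hmgf)

end Chernoff

section StandardGaussian

lemma gaussianPDFReal_zero_one (x : ℝ) :
    gaussianPDFReal 0 1 x = (√(2 * Real.pi))⁻¹ * Real.exp (-(1 / 2) * x ^ 2) := by
  simp [gaussianPDFReal]
  left; ring

lemma integrable_gaussianReal_zero_one_iff (f : ℝ → ℝ) :
    Integrable f (gaussianReal 0 1) ↔
      Integrable (fun x => Real.exp (-(1 / 2) * x ^ 2) * f x) volume := by
  rw [gaussianReal_of_var_ne_zero _ one_ne_zero, integrable_withDensity_iff_integrable_smul'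
    (measurable_gaussianPDF 0 1) (ae_of_all _ fun _ => gaussianPDF_lt_top)]
  simp only [toReal_gaussianPDF, gaussianPDFReal_zero_one, smul_eq_mul, mul_assoc]
  rw [integrable_const_mul_iff]
  exact IsUnit.mk0 _ (by positivity)

lemma integral_gaussianReal_zero_one (f : ℝ → ℝ) :
    ∫ x, f x ∂(gaussianReal 0 1) =
      (√(2 * Real.pi))⁻¹ * ∫ x, Real.exp (-(1 / 2) * x ^ 2) * f x := by
  rw [integral_gaussianReal_eq_integral_smul one_ne_zero, ← integral_const_mul]
  simp only [gaussianPDFReal_zero_one, smul_eq_mul, mul_assoc]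

lemma integrable_exp_mul_sq_gaussianReal {t : ℝ} (ht : t < 1 / 2) :
    Integrable (fun x : ℝ => Real.exp (t * x ^ 2)) (gaussianReal 0 1) := by
  rw [integrable_gaussianReal_zero_one_iff]
  simp only [← Real.exp_add]
  convert integrable_exp_neg_mul_sq (show 0 < 1 / 2 - t by linarith) using 3
  ring

lemma integral_exp_mul_sq_gaussianReal {t : ℝ} (ht : t < 1 / 2) :
    ∫ x : ℝ, Real.exp (t * x ^ 2) ∂(gaussianReal 0 1) = (√(1 - 2 * t))⁻¹ := by
  rw [integral_gaussianReal_zero_one]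
  simp only [← Real.exp_add]
  have h : ∀ x : ℝ, -(1 / 2) * x ^ 2 + t * x ^ 2 = -(1 / 2 - t) * x ^ 2 := fun x => by ring
  simp only [h]
  rw [integral_gaussian, ← Real.sqrt_inv, ← Real.sqrt_mul (by positivity), ← Real.sqrt_inv]
  congr 1
  have : 1 - 2 * t ≠ 0 := by linarith
  have h' : 1 / 2 - t ≠ 0 := by linarith
  have h2 : (1 / 2 - t) = (1 - 2 * t) / 2 := by ring
  rw [h2]
  field_simp

lemma integrable_abs_gaussianReal : Integrable (fun x : ℝ => |x|) (gaussianReal 0 1) :=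
  (memLp_id_gaussianReal (μ := 0) (v := 1) 1).integrable le_rfl |>.abs

lemma integrable_sq_gaussianReal : Integrable (fun x : ℝ => x ^ 2) (gaussianReal 0 1) :=
  (memLp_id_gaussianReal (μ := 0) (v := 1) 2).integrable_sq

lemma integral_sq_gaussianReal : ∫ x : ℝ, x ^ 2 ∂(gaussianReal 0 1) = 1 := by
  have h := variance_fun_id_gaussianReal (μ := 0) (v := 1)
  rw [variance_eq_integral (by fun_prop)] at h
  simpa using h

lemma integral_abs_gaussianReal : ∫ x : ℝ, |x| ∂(gaussianReal 0 1) = √(2 / Real.pi) := by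
  rw [integral_gaussianReal_zero_one]
  have h1 : ∀ x : ℝ, Real.exp (-(1 / 2) * x ^ 2) * |x|
      = (fun y => y * Real.exp (-(1 / 2) * y ^ 2)) |x| := fun x => by simp [mul_comm]
  simp only [h1]
  rw [integral_comp_abs (f := fun y => y * Real.exp (-(1 / 2) * y ^ 2))]
  have h2 := integral_rpow_mul_exp_neg_mul_rpow (p := 2) (q := 1) (b := 1 / 2) two_pos
    (by norm_num) (by norm_num)
  simp only [Real.rpow_one, Real.rpow_two] at h2
  rw [h2]
  norm_num [Real.rpow_neg_one]
  have := Real.sqrt_pos.2 Real.pi_pos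
  have h3 := Real.mul_self_sqrt (show (0 : ℝ) ≤ 2 by norm_num)
  field_simp
  nlinarith

lemma exp_neg_le_quadratic {x : ℝ} (hx : 0 ≤ x) : Real.exp (-x) ≤ 1 - x + x ^ 2 / 2 := by
  have h1 := Real.quadratic_le_exp_of_nonneg hx
  rw [Real.exp_neg]
  have h2 : 0 < 1 + x + x ^ 2 / 2 := by positivity
  refine (inv_anti₀ h2 h1).trans ?_
  rw [inv_le_iff_one_le_mul₀ h2]
  nlinarith [sq_nonneg (x ^ 2)]

lemma mgf_abs_gaussianReal_le : ∫ x : ℝ, Real.exp (-0.1 * |x|) ∂(gaussianReal 0 1) ≤ 0.926 := by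
  have h1 : ∀ x : ℝ, Real.exp (-0.1 * |x|) ≤ 1 - 0.1 * |x| + 0.005 * x ^ 2 := fun x => by
    have := exp_neg_le_quadratic (show 0 ≤ 0.1 * |x| by positivity)
    rw [mul_pow, sq_abs] at this
    rw [neg_mul]
    norm_num at this ⊢
    linarith
  have hi₀ : Integrable (fun x : ℝ => 1 - 0.1 * |x|) (gaussianReal 0 1) :=
    (integrable_const _).sub (integrable_abs_gaussianReal.const_mul _)
  have hi : Integrable (fun x : ℝ => 1 - 0.1 * |x| + 0.005 * x ^ 2) (gaussianReal 0 1) :=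
    hi₀.add (integrable_sq_gaussianReal.const_mul _)
  refine (integral_mono_of_nonneg (ae_of_all _ fun x => (Real.exp_pos _).le) hi
    (ae_of_all _ h1)).trans ?_
  rw [integral_add hi₀ (integrable_sq_gaussianReal.const_mul _),
    integral_sub (integrable_const _) (integrable_abs_gaussianReal.const_mul _),
    integral_const_mul, integral_const_mul, integral_abs_gaussianReal, integral_sq_gaussianReal]
  have h2 : 0.79 ≤ √(2 / Real.pi) := by
    refine Real.le_sqrt_of_sq_le ?_
    rw [le_div_iff₀ Real.pi_pos]
    have := Real.pi_lt_d2
    norm_num at this ⊢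
    linarith
  simp
  norm_num at h2 ⊢
  linarith

end StandardGaussian

section TailBounds

variable {Ω : Type*} [MeasurableSpace Ω] {P : Measure Ω} {p : ℕ} {W : Fin p → Ω → ℝ}

lemma exp_nat_mul_bound {a m : ℝ} (hm : 0 ≤ m) (h : Real.exp a * m ≤ 0.996) (p : ℕ) :
    Real.exp (a * p) * m ^ p ≤ Real.exp (-(p / 250)) := by
  have h1 : Real.exp (a * p) = Real.exp a ^ p := by rw [← Real.exp_nat_mul, mul_comm]
  have h2 : Real.exp (-(p / 250)) = Real.exp (-(1 / 250)) ^ p := by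
    rw [← Real.exp_nat_mul]; congr 1; ring
  rw [h1, h2, ← mul_pow]
  refine pow_le_pow_left₀ (by positivity) (h.trans ?_) p
  have := Real.add_one_le_exp (-(1 / 250) : ℝ)
  norm_num at this ⊢
  linarith

/-- The `ℓ¹` norm of a standard Gaussian vector is rarely below `0.7 p`. -/
lemma gaussian_l1_lower_tail (hW : iIndepFun W P) (hl : ∀ i, HasLaw (W i) (gaussianReal 0 1) P) :
    P.real {ω | ∑ i, |W i ω| ≤ 0.7 * p} ≤ Real.exp (-(p / 250)) := by
  have := hW.isProbabilityMeasure
  have hm : ∀ i, AEMeasurable (fun ω => |W i ω|) P := fun i => (hl i).aemeasurable.abs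
  have hi : iIndepFun (fun i ω => |W i ω|) P := hW.comp (fun _ x => |x|) fun _ => by fun_prop
  have hint : ∀ i, Integrable (fun ω => Real.exp (-0.1 * |W i ω|)) P := fun i => by
    refine Integrable.of_bound ((hm i).const_mul _).exp.aestronglyMeasurable 1 (ae_of_all _ fun ω => ?_)
    rw [Real.norm_eq_abs, Real.abs_exp, Real.exp_le_one_iff]
    have := abs_nonneg (W i ω)
    norm_num
  have hmgf : ∀ i, mgf (fun ω => |W i ω|) P (-0.1) ≤ 0.926 := fun i => by
    refine le_trans (le_of_eq ?_) mgf_abs_gaussianReal_le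
    exact (hl i).integral_comp (f := fun x : ℝ => Real.exp (-0.1 * |x|)) (by fun_prop)
  refine (chernoff_le hi hm (by norm_num) hint hmgf _).trans ?_
  have h := exp_nat_mul_bound (a := 0.07) (m := 0.926) (by norm_num) (by
    have h1 := Real.one_sub_le_exp_neg (0.07 : ℝ)
    have h2 : Real.exp 0.07 * Real.exp (-0.07) = 1 := by rw [← Real.exp_add]; simp
    have h3 := Real.exp_pos (0.07 : ℝ)
    norm_num at h1 h2 h3 ⊢
    nlinarith) p
  refine le_trans (le_of_eq ?_) h
  rw [Fintype.card_fin]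
  congr 2
  ring

/-- The squared `ℓ²` norm of a standard Gaussian vector is rarely above `1.21 p`. -/
lemma gaussian_l2_upper_tail (hW : iIndepFun W P) (hl : ∀ i, HasLaw (W i) (gaussianReal 0 1) P) :
    P.real {ω | 1.21 * p ≤ ∑ i, W i ω ^ 2} ≤ Real.exp (-(p / 250)) := by
  have hm : ∀ i, AEMeasurable (fun ω => W i ω ^ 2) P := fun i => (hl i).aemeasurable.pow_const 2
  have hi : iIndepFun (fun i ω => W i ω ^ 2) P := hW.comp (fun _ x => x ^ 2) fun _ => by fun_prop
  have hint : ∀ i, Integrable (fun ω => Real.exp (0.08 * W i ω ^ 2)) P := fun i => by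
    have h := integrable_exp_mul_sq_gaussianReal (t := 0.08) (by norm_num)
    rw [← (hl i).map_eq] at h
    exact h.comp_aemeasurable (hl i).aemeasurable
  have hmgf : ∀ i, mgf (fun ω => W i ω ^ 2) P 0.08 ≤ (√0.84)⁻¹ := fun i => by
    have h1 := integral_exp_mul_sq_gaussianReal (t := 0.08) (by norm_num)
    rw [show (1 - 2 * 0.08 : ℝ) = 0.84 by norm_num] at h1
    rw [← h1]
    exact le_of_eq ((hl i).integral_comp (f := fun x : ℝ => Real.exp (0.08 * x ^ 2))
      (by fun_prop))
  refine (chernoff_ge hi hm (by norm_num) hint hmgf _).trans ?_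
  have h := exp_nat_mul_bound (a := -0.0968) (m := (√0.84)⁻¹) (by positivity) (by
    have h1 := Real.quadratic_le_exp_of_nonneg (show (0 : ℝ) ≤ 0.0968 by norm_num)
    have h2 : 0.916 ≤ √0.84 := Real.le_sqrt_of_sq_le (by norm_num)
    rw [Real.exp_neg, ← mul_inv]
    refine inv_le_of_inv_le₀ (by norm_num) ?_
    calc (0.996 : ℝ)⁻¹ ≤ (1 + 0.0968 + 0.0968 ^ 2 / 2) * 0.916 := by norm_num
      _ ≤ _ := by gcongr) p
  refine le_trans (le_of_eq ?_) h
  rw [Fintype.card_fin]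
  congr 2
  ring

end TailBounds

section GaussianMatrix

variable {Ω : Type*} [MeasurableSpace Ω] {P : Measure Ω} {p d : ℕ}
  {G : Ω → Matrix (Fin p) (Fin d) ℝ}

lemma covariance_gaussian_entries {v : NNReal}
    (hl : ∀ k l, HasLaw (fun ω => G ω k l) (gaussianReal 0 v) P)
    (hi : iIndepFun (fun (kl : Fin p × Fin d) (ω : Ω) => G ω kl.1 kl.2) P)
    (k k' : Fin p) (l l' : Fin d) :
    cov[fun ω => G ω k l, fun ω => G ω k' l'; P] = if (k, l) = (k', l') then (v : ℝ) else 0 := by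
  have hm : ∀ k l, MemLp (fun ω => G ω k l) 2 P := fun k l =>
    (hl k l).hasGaussianLaw.memLp_two
  split_ifs with h
  · obtain ⟨rfl, rfl⟩ := Prod.mk.inj h
    rw [covariance_self (hl k l).aemeasurable, (hl k l).variance_eq, variance_id_gaussianReal]
  · exact (hi.indepFun h).covariance_eq_zero (hm k l) (hm k' l')

lemma covariance_gaussian_rows {v : NNReal}
    (hl : ∀ k l, HasLaw (fun ω => G ω k l) (gaussianReal 0 v) P)
    (hi : iIndepFun (fun (kl : Fin p × Fin d) (ω : Ω) => G ω kl.1 kl.2) P)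
    (c : Fin d → ℝ) (k k' : Fin p) :
    cov[fun ω => ∑ l, c l * G ω k l, fun ω => ∑ l, c l * G ω k' l; P] =
      if k = k' then v * ∑ l, c l ^ 2 else 0 := by
  have hm : ∀ k l, MemLp (fun ω => c l * G ω k l) 2 P := fun k l =>
    (hl k l).hasGaussianLaw.memLp_two.const_mul _
  have := hi.isProbabilityMeasure
  rw [covariance_fun_sum_fun_sum (hm k) (hm k')]
  simp only [covariance_const_mul_left, covariance_const_mul_right,
    covariance_gaussian_entries hl hi, Prod.mk.injEq]
  split_ifs with h
  · simp only [h, true_and, mul_ite, mul_zero, Finset.sum_ite_eq, Finset.mem_univ, if_true,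
      Finset.mul_sum]
    exact Finset.sum_congr rfl fun l _ => by ring
  · simp [h]

/-- The entries of `√p G c` for a unit vector `c` are independent standard Gaussians. -/
lemma gaussian_rows (hp : 0 < p)
    (hl : ∀ k l, HasLaw (fun ω => G ω k l) (gaussianReal 0 (1 / (p : NNReal))) P)
    (hi : iIndepFun (fun (kl : Fin p × Fin d) (ω : Ω) => G ω kl.1 kl.2) P)
    {c : Fin d → ℝ} (hc : ∑ l, c l ^ 2 = 1) :
    iIndepFun (fun (k : Fin p) (ω : Ω) => √p * (G ω *ᵥ c) k) P ∧
      ∀ k, HasLaw (fun ω => √p * (G ω *ᵥ c) k) (gaussianReal 0 1) P := by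
  have := hi.isProbabilityMeasure
  have hW : ∀ ω k, √p * (G ω *ᵥ c) k = ∑ l, (√p * c l) * G ω k l := fun ω k => by
    simp only [mulVec, dotProduct, Finset.mul_sum]
    exact Finset.sum_congr rfl fun l _ => by ring
  simp only [hW]
  have hjoint : HasGaussianLaw
      (fun ω => (fun kl : Fin p × Fin d => G ω kl.1 kl.2)) P :=
    hi.hasGaussianLaw fun kl => (hl kl.1 kl.2).hasGaussianLaw
  let L : (Fin p × Fin d → ℝ) →L[ℝ] (Fin p → ℝ) :=
    ContinuousLinearMap.pi fun k =>
      ∑ l, (√p * c l) • ContinuousLinearMap.proj (R := ℝ) (φ := fun _ : Fin p × Fin d => ℝ) (k, l)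
  have hL : HasGaussianLaw (fun ω => fun k : Fin p => ∑ l, (√p * c l) * G ω k l) P := by
    have h := hjoint.map_fun L
    have e : (fun ω => L fun kl : Fin p × Fin d => G ω kl.1 kl.2) =
        fun ω => fun k : Fin p => ∑ l, (√p * c l) * G ω k l := by
      ext ω k; simp [L]
    rwa [e] at h
  have hcov := covariance_gaussian_rows hl hi (fun l => √p * c l)
  refine ⟨hL.iIndepFun_of_covariance_eq_zero fun k k' hkk => by rw [hcov, if_neg hkk], fun k => ?_⟩
  have hk : HasGaussianLaw (fun ω => ∑ l, (√p * c l) * G ω k l) P := hL.eval k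
  have hmean : ∫ ω, ∑ l, (√p * c l) * G ω k l ∂P = 0 := by
    rw [integral_finsetSum _ fun l _ => ((hl k l).hasGaussianLaw.integrable.const_mul _)]
    refine Finset.sum_eq_zero fun l _ => ?_
    rw [integral_const_mul, (hl k l).integral_eq, integral_id_gaussianReal, mul_zero]
  have hvar : Var[fun ω => ∑ l, (√p * c l) * G ω k l; P] = 1 := by
    rw [← covariance_self hk.aemeasurable, hcov, if_pos rfl]
    simp only [mul_pow, ← Finset.mul_sum, hc, Real.sq_sqrt (Nat.cast_nonneg p)]
    have : (p : ℝ) ≠ 0 := by positivity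
    push_cast
    field_simp
  refine ⟨hk.aemeasurable, ?_⟩
  rw [hk.map_eq_gaussianReal, hmean, hvar, Real.toNNReal_one]

/-- A tall Gaussian matrix is spread with overwhelming probability. -/
lemma gaussian_isSpread (hp : 0 < p) (hpd : 2000 * (d : ℝ) ≤ p)
    (hl : ∀ k l, HasLaw (fun ω => G ω k l) (gaussianReal 0 (1 / (p : NNReal))) P)
    (hi : iIndepFun (fun (kl : Fin p × Fin d) (ω : Ω) => G ω kl.1 kl.2) P) :
    P.real {ω | ¬ IsSpread 0.55 (G ω)} ≤ 2 * Real.exp (-(p / 500)) := by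
  have := hi.isProbabilityMeasure
  obtain ⟨s, hs1, hs2, hs3⟩ := exists_net_sphere (E := EuclideanSpace ℝ (Fin d))
    (show (0 : ℝ) < 1 / 20 by norm_num)
  have hp' : (0 : ℝ) < p := by exact_mod_cast hp
  have hsp : 0 < √(p : ℝ) := Real.sqrt_pos.2 hp'
  have hsq : √(p : ℝ) * √p = p := Real.mul_self_sqrt hp'.le
  let B : EuclideanSpace ℝ (Fin d) → Set Ω := fun c =>
    {ω | ∑ i, |√p * (G ω *ᵥ c.ofLp) i| ≤ 0.7 * p} ∪
      {ω | 1.21 * p ≤ ∑ i, (√p * (G ω *ᵥ c.ofLp) i) ^ 2}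
  have hsub : {ω | ¬ IsSpread 0.55 (G ω)} ⊆ ⋃ c ∈ s, B c := by
    intro ω hω
    by_contra hB
    apply hω
    simp only [Set.mem_iUnion, not_exists, B, Set.mem_union, not_or, Set.mem_ofPred_eq,
      not_le] at hB
    refine isSpread_of_net (G ω) s hs2 (fun c hc => ?_) fun c hc => ?_
    · have h := (hB c hc).2
      simp only [mul_pow, Real.sq_sqrt hp'.le, ← Finset.mul_sum] at h
      rw [mul_comm (1.21 : ℝ)] at h
      exact (lt_of_mul_lt_mul_left h hp'.le).le
    · have h := (hB c hc).1
      simp only [abs_mul, abs_of_pos hsp, ← Finset.mul_sum] at h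
      nth_rw 1 [← hsq] at h
      rw [← mul_assoc, mul_comm] at h
      exact lt_of_mul_lt_mul_left h hsp.le
  have hB : ∀ c ∈ s, P.real (B c) ≤ 2 * Real.exp (-(p / 250)) := fun c hc => by
    have hc1 : ∑ l, c l ^ 2 = 1 := by
      rw [← EuclideanSpace.real_norm_sq_eq, hs1 c hc, one_pow]
    obtain ⟨hind, hlaw⟩ := gaussian_rows hp hl hi hc1
    refine (measureReal_union_le _ _).trans ?_
    linarith [gaussian_l1_lower_tail hind hlaw, gaussian_l2_upper_tail hind hlaw]
  have hcard : (s.card : ℝ) ≤ Real.exp (p / 500) := by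
    refine hs3.trans ?_
    rw [finrank_euclideanSpace_fin]
    have h41 : (1 + 2 / (1 / 20) : ℝ) ≤ Real.exp 4 := by
      have h := Real.exp_one_gt_d9
      have : Real.exp 4 = Real.exp 1 ^ 4 := by rw [← Real.exp_nat_mul]; norm_num
      rw [this]
      calc (1 + 2 / (1 / 20) : ℝ) ≤ 2.7 ^ 4 := by norm_num
        _ ≤ _ := by gcongr; linarith
    calc _ ≤ Real.exp 4 ^ d := by gcongr
      _ = Real.exp (d * 4) := by rw [Real.exp_nat_mul]
      _ ≤ _ := by gcongr; linarith
  calc _ ≤ P.real (⋃ c ∈ s, B c) := measureReal_mono hsub (measure_ne_top _ _)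
    _ ≤ ∑ c ∈ s, P.real (B c) := measureReal_biUnion_finset_le _ _
    _ ≤ ∑ c ∈ s, 2 * Real.exp (-(p / 250)) := Finset.sum_le_sum hB
    _ = s.card * (2 * Real.exp (-(p / 250))) := by rw [Finset.sum_const, nsmul_eq_mul]
    _ ≤ Real.exp (p / 500) * (2 * Real.exp (-(p / 250))) := by gcongr
    _ = 2 * Real.exp (-(p / 500)) := by
      rw [mul_left_comm, ← Real.exp_add]; congr 2; ring

end GaussianMatrix

section Bernoulli

variable {Ω : Type*} [MeasurableSpace Ω] {P : Measure Ω} {p : ℕ} {x : Ω → Fin p → ℝ} {θ : ℝ}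

lemma mgf_scaledBernoulli (hθ0 : 0 < θ) (hθ1 : θ < 1) (hp : 0 < p) {X : Ω → ℝ}
    (hX : HasLaw X (scaledBernoulli θ p) P) (t : ℝ) :
    mgf (fun ω => √(θ * p) * X ω) P t = 1 + θ * (Real.exp t - 1) := by
  have hs : √(θ * p) ≠ 0 := (Real.sqrt_pos.2 (by positivity)).ne'
  have h := hX.integral_comp (f := fun y : ℝ => Real.exp (t * (√(θ * p) * y))) (by fun_prop)
  refine h.trans ?_
  rw [scaledBernoulli, integral_add_measure, integral_smul_measure, integral_smul_measure,
    integral_dirac, integral_dirac, ENNReal.toReal_ofReal hθ0.le,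
    ENNReal.toReal_ofReal (by linarith), mul_one_div_cancel hs]
  · simp; ring
  · exact (integrable_dirac (by simp)).smul_measure ENNReal.ofReal_ne_top
  · exact (integrable_dirac (by simp)).smul_measure ENNReal.ofReal_ne_top

lemma ae_scaledBernoulli {X : Ω → ℝ} (hX : HasLaw X (scaledBernoulli θ p) P) :
    ∀ᵐ ω ∂P, X ω = 1 / √(θ * p) ∨ X ω = 0 := by
  rw [hX.ae_iff (p := fun y => y = 1 / √(θ * p) ∨ y = 0) (by
    refine measurableSet_setOfPred.1 ?_
    exact (MeasurableSet.singleton _).union (MeasurableSet.singleton _))]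
  rw [scaledBernoulli, ae_add_measure_iff]
  refine ⟨Measure.ae_smul_measure ?_ _, Measure.ae_smul_measure ?_ _⟩
  · simp [ae_dirac_eq]
  · simp [ae_dirac_eq]

/-- Chernoff bounds for the size of the support of a scaled Bernoulli vector. -/
lemma bernoulli_support_tails (hθ0 : 0 < θ) (hθ1 : θ < 1) (hp : 0 < p)
    (hl : ∀ k, HasLaw (fun ω => x ω k) (scaledBernoulli θ p) P)
    (hi : iIndepFun (fun (k : Fin p) (ω : Ω) => x ω k) P) :
    P.real {ω | 1.1 * (θ * p) ≤ ∑ k, √(θ * p) * x ω k} ≤ Real.exp (-(θ * p / 500)) ∧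
      P.real {ω | ∑ k, √(θ * p) * x ω k ≤ 0} ≤ Real.exp (-(θ * p / 500)) := by
  have hm : ∀ k, AEMeasurable (fun ω => √(θ * p) * x ω k) P := fun k =>
    (hl k).aemeasurable.const_mul _
  have hi' : iIndepFun (fun (k : Fin p) (ω : Ω) => √(θ * p) * x ω k) P :=
    hi.comp (fun _ y => √(θ * p) * y) fun _ => by fun_prop
  have hpos : ∀ t : ℝ, 0 < 1 + θ * (Real.exp t - 1) := fun t => by
    nlinarith [Real.exp_pos t]
  have := hi.isProbabilityMeasure
  have hint : ∀ t k, Integrable (fun ω => Real.exp (t * (√(θ * p) * x ω k))) P := fun t k => by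
    rw [← mgf_pos_iff (X := fun ω => √(θ * p) * x ω k),
      mgf_scaledBernoulli hθ0 hθ1 hp (hl k)]
    exact hpos t
  have hpow : ∀ t : ℝ, (1 + θ * (Real.exp t - 1)) ^ p ≤ Real.exp (θ * p * (Real.exp t - 1)) := by
    intro t
    have h1 : Real.exp (θ * p * (Real.exp t - 1)) = Real.exp (θ * (Real.exp t - 1)) ^ p := by
      rw [← Real.exp_nat_mul]; congr 1; ring
    rw [h1]
    refine pow_le_pow_left₀ (hpos t).le ?_ p
    linarith [Real.add_one_le_exp (θ * (Real.exp t - 1))]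
  have hθp : 0 < θ * p := by positivity
  constructor
  · refine (chernoff_ge hi' hm (t := 0.05) (by norm_num) (hint _)
      (fun k => (mgf_scaledBernoulli hθ0 hθ1 hp (hl k) _).le) _).trans ?_
    rw [Fintype.card_fin]
    refine (mul_le_mul_of_nonneg_left (hpow _) (Real.exp_pos _).le).trans ?_
    rw [← Real.exp_add, Real.exp_le_exp]
    have h := Real.exp_bound_div_one_sub_of_interval (x := 0.05) (by norm_num) (by norm_num)
    have h' : Real.exp 0.05 - 1 ≤ 0.0527 := by norm_num at h ⊢; linarith
    have := mul_le_mul_of_nonneg_left h' hθp.le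
    norm_num at this ⊢
    nlinarith
  · refine (chernoff_le hi' hm (t := -1) (by norm_num) (hint _)
      (fun k => (mgf_scaledBernoulli hθ0 hθ1 hp (hl k) _).le) _).trans ?_
    rw [Fintype.card_fin, mul_zero, Real.exp_zero, one_mul]
    refine (hpow _).trans ?_
    rw [Real.exp_le_exp]
    have h := exp_neg_le_quadratic (x := 1) (by norm_num)
    have h' : Real.exp (-1) - 1 ≤ -(1 / 2) := by linarith
    have := mul_le_mul_of_nonneg_left h' hθp.le
    linarith

end Bernoulli

section Rotation

variable {p d : ℕ}

lemma inner_eq_dotProduct {n : ℕ} (q r : EuclideanSpace ℝ (Fin n)) :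
    inner ℝ q r = q.ofLp ⬝ᵥ r.ofLp := by
  simp [PiLp.inner_apply, dotProduct, mul_comm]

lemma inner_orthogonal_mulVec {n : ℕ} {U : Matrix (Fin n) (Fin n) ℝ}
    (hU : U ∈ Matrix.orthogonalGroup (Fin n) ℝ) (q r : EuclideanSpace ℝ (Fin n)) :
    inner ℝ (WithLp.toLp 2 (U *ᵥ q.ofLp) : EuclideanSpace ℝ (Fin n)) (WithLp.toLp 2 (U *ᵥ r.ofLp)) =
      inner ℝ q r := by
  have h : Uᵀ * U = 1 := Matrix.mem_orthogonalGroup_iff' _ _ |>.1 hU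
  rw [inner_eq_dotProduct, inner_eq_dotProduct, dotProduct_mulVec, vecMul_mulVec, h, vecMul_one]

lemma canonicalBasis_mulVec_e1 (x : Fin p → ℝ) (G : Matrix (Fin p) (Fin d) ℝ) :
    canonicalBasis x G *ᵥ (e1 : EuclideanSpace ℝ (Fin (d + 1))).ofLp = (√(x ⬝ᵥ x))⁻¹ • x := by
  have ht : Fin.tail (e1 : EuclideanSpace ℝ (Fin (d + 1))).ofLp = 0 := by
    ext l; simp [Fin.tail, e1]
  ext i
  rw [canonicalBasis_mulVec, ht]
  simp [e1]
  ring

/-- Rounding success is invariant under an orthogonal change of basis. -/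
lemma roundingSucceeds_mul_orthogonal {θ : ℝ} {x : Fin p → ℝ} {G : Matrix (Fin p) (Fin d) ℝ}
    (hθ : 0 < θ) (hx : 0 < x ⬝ᵥ x)
    (h : ∀ r : EuclideanSpace ℝ (Fin (d + 1)), ‖r‖ = 1 → 2 * √θ < |r 0| →
      ∀ q : EuclideanSpace ℝ (Fin (d + 1)), inner ℝ r q = 1 →
        q ≠ (r 0)⁻¹ • (e1 : EuclideanSpace ℝ (Fin (d + 1))) →
        l1Obj (canonicalBasis x G) ((r 0)⁻¹ • (e1 : EuclideanSpace ℝ (Fin (d + 1))))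
          < l1Obj (canonicalBasis x G) q)
    {U : Matrix (Fin (d + 1)) (Fin (d + 1)) ℝ} (hU : U ∈ Matrix.orthogonalGroup (Fin (d + 1)) ℝ) :
    RoundingSucceeds θ x (canonicalBasis x G * U)
      (WithLp.toLp 2 (Uᵀ *ᵥ (e1 : EuclideanSpace ℝ (Fin (d + 1))).ofLp)) := by
  intro lam _ q₀ _ K r _ hr hr0
  have hUU : U * Uᵀ = 1 := Matrix.mem_orthogonalGroup_iff _ _ |>.1 hU
  have hUU' : Uᵀ * U = 1 := Matrix.mem_orthogonalGroup_iff' _ _ |>.1 hU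
  let R : EuclideanSpace ℝ (Fin (d + 1)) → EuclideanSpace ℝ (Fin (d + 1)) := fun q =>
    WithLp.toLp 2 (U *ᵥ q.ofLp)
  set v : EuclideanSpace ℝ (Fin (d + 1)) :=
    WithLp.toLp 2 (Uᵀ *ᵥ (e1 : EuclideanSpace ℝ (Fin (d + 1))).ofLp) with hv
  have hRv : R v = e1 := by simp [R, hv, hUU]
  have hRs : ∀ (a : ℝ) q, R (a • q) = a • R q := fun a q => by
    simp [R, mulVec_smul]
  have hRinj : Function.Injective R := fun q q' hqq => by
    have h1 := congrArg (fun z : EuclideanSpace ℝ (Fin (d + 1)) => Uᵀ *ᵥ z.ofLp) hqq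
    simp only [R, mulVec_mulVec, hUU', one_mulVec] at h1
    exact WithLp.ofLp_injective 2 h1
  have hl : ∀ q, l1Obj (canonicalBasis x G * U) q = l1Obj (canonicalBasis x G) (R q) := fun q => by
    simp [l1Obj, R, mulVec_mulVec]
  have hinner : ∀ q q', inner ℝ (R q) (R q') = inner ℝ q q' := inner_orthogonal_mulVec hU
  have hr' : inner ℝ r v = R r 0 := by
    rw [← hinner, hRv]
    simp [e1, EuclideanSpace.inner_single_right]
  have hnorm : ‖R r‖ = 1 := by
    rw [← hr, @norm_eq_sqrt_real_inner _ _ _ (R r), @norm_eq_sqrt_real_inner _ _ _ r, hinner]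
  rw [hr'] at hr0 ⊢
  have h0 : R r 0 ≠ 0 := by
    have := Real.sqrt_pos.2 hθ
    exact abs_pos.1 (by linarith)
  refine ⟨⟨?_, fun q hq hne => ?_⟩, (R r 0)⁻¹ * (√(x ⬝ᵥ x))⁻¹, ?_, ?_⟩
  · rw [inner_smul_right, hr', inv_mul_cancel₀ h0]
  · rw [hl, hl, hRs, hRv]
    refine h (R r) hnorm hr0 (R q) (by rw [hinner, hq]) fun hRq => hne (hRinj ?_)
    rw [hRq, hRs, hRv]
  · exact mul_ne_zero (inv_ne_zero h0) (inv_ne_zero (Real.sqrt_pos.2 hx).ne')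
  · rw [WithLp.ofLp_smul, mulVec_smul, ← mulVec_mulVec]
    have : U *ᵥ v.ofLp = (e1 : EuclideanSpace ℝ (Fin (d + 1))).ofLp :=
      congrArg WithLp.ofLp hRv
    rw [this, canonicalBasis_mulVec_e1, smul_smul]

end Rotation

lemma exp_neg_le_two_div_sq {y : ℝ} (hy : 0 < y) : Real.exp (-y) ≤ 2 / y ^ 2 := by
  have h := Real.quadratic_le_exp_of_nonneg hy.le
  rw [Real.exp_neg, inv_le_comm₀ (Real.exp_pos _) (by positivity), inv_div]
  linarith

lemma exp_neg_le_div_pow_four {y : ℝ} (hy : 0 < y) : Real.exp (-y) ≤ 24 / y ^ 4 := by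
  have h := Real.pow_div_factorial_le_exp y hy.le 4
  rw [Real.exp_neg, inv_le_comm₀ (Real.exp_pos _) (by positivity), inv_div]
  simpa [Nat.factorial] using h

/-- On the good event, the canonical basis is well defined and rounding succeeds in every
orthogonal coordinate system. -/
lemma wellDefined_and_roundingSucceeds {p d : ℕ} {x : Fin p → ℝ} {G : Matrix (Fin p) (Fin d) ℝ}
    {θ : ℝ} (hp : 0 < p) (hθ0 : 0 < θ) (hθ1 : θ < 1 / 10 ^ 6)
    (hx : ∀ k, x k = 1 / √(θ * p) ∨ x k = 0)
    (hup : ∑ k, √(θ * p) * x k < 1.1 * (θ * p)) (hlow : 0 < ∑ k, √(θ * p) * x k)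
    (hG : IsSpread 0.55 G) :
    CanonicalBasisWellDefined x G ∧ ∀ U ∈ Matrix.orthogonalGroup (Fin (d + 1)) ℝ,
      RoundingSucceeds θ x (canonicalBasis x G * U)
        (WithLp.toLp 2 (Uᵀ *ᵥ (e1 : EuclideanSpace ℝ (Fin (d + 1))).ofLp)) := by
  have hp' : (0 : ℝ) < p := by exact_mod_cast hp
  have hs : 0 < √(θ * p) := Real.sqrt_pos.2 (by positivity)
  have hτ : 0 < 1 / √(θ * p) := by positivity
  obtain ⟨I, hxI⟩ : ∃ I : Finset (Fin p), ∀ i, x i = if i ∈ I then 1 / √(θ * p) else 0 := by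
    refine ⟨Finset.univ.filter fun k => x k ≠ 0, fun i => ?_⟩
    rcases hx i with h | h
    · rw [if_pos (by rw [Finset.mem_filter, h]; exact ⟨Finset.mem_univ _, hτ.ne'⟩), h]
    · rw [if_neg (by simp [h]), h]
  have hsum : ∑ k, √(θ * p) * x k = I.card := by
    simp only [hxI, mul_ite, mul_zero, mul_one_div_cancel hs.ne', Finset.sum_ite_mem,
      Finset.univ_inter, Finset.sum_const, nsmul_eq_mul, mul_one]
  rw [hsum] at hup hlow
  have hI : 0 < I.card := by exact_mod_cast hlow
  have hxx : 0 < x ⬝ᵥ x := by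
    rw [two_valued_dotProduct_self hxI]; positivity
  have hθ' : 0 < √θ := Real.sqrt_pos.2 hθ0
  have hθ'' : √θ ≤ 0.001 := Real.sqrt_le_iff.2 ⟨by norm_num, by norm_num at hθ1 ⊢; linarith⟩
  have hcard : √I.card ≤ 1.05 * (√θ * √p) := by
    refine Real.sqrt_le_iff.2 ⟨by positivity, ?_⟩
    rw [mul_pow, mul_pow, Real.sq_sqrt hθ0.le, Real.sq_sqrt hp'.le]
    have : 0 < θ * p := by positivity
    norm_num at hup ⊢
    linarith
  have hβ : √I.card * (3 + 1 / (2 * √θ)) ≤ 0.55 * √p := by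
    calc _ ≤ 1.05 * (√θ * √p) * (3 + 1 / (2 * √θ)) := by gcongr
      _ = (1.05 * (3 * √θ + 1 / 2)) * √p := by field_simp
      _ ≤ _ := by
        gcongr
        norm_num at hθ'' ⊢
        linarith
  have hβ' : 3 * √I.card ≤ 0.55 * √p := by
    refine le_trans ?_ hβ
    have : 0 ≤ √(I.card : ℝ) * (1 / (2 * √θ)) := by positivity
    linarith
  have hwd := canonicalBasisWellDefined_of_isSpread hτ hI hxI hβ' hG
  exact ⟨hwd, fun U hU => roundingSucceeds_mul_orthogonal hθ0 hxx
    (fun r hr hr0 q hq hne => l1Obj_lt_of_isSpread hτ hI hxI hθ0 hβ hG hwd.2 hr hr0 hq hne) hU⟩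

end PlantedSparse

theorem proposition5 :
    ∃ θ₀ : ℝ, 0 < θ₀ ∧ θ₀ < 1 ∧ ∃ C : ℝ, 0 < C ∧ ∃ c : ℝ, 0 < c ∧
      ∀ (n p d : ℕ), n = d + 1 → C * (n : ℝ) ≤ (p : ℝ) →
      ∀ θ : ℝ, 1 / √(n : ℝ) < θ → θ < θ₀ →
      ∀ {Ω : Type*} [MeasurableSpace Ω] (P : Measure Ω) [IsProbabilityMeasure P]
        (x₀ : Ω → Fin p → ℝ) (G : Ω → Matrix (Fin p) (Fin d) ℝ),
        PlantedSparse.IsPlantedSparseModel θ P x₀ G →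
        ∃ E : Set Ω, MeasurableSet E ∧ 1 - c * ((p : ℝ) ^ 2)⁻¹ ≤ P.real E ∧
          ∀ ω ∈ E,
            PlantedSparse.CanonicalBasisWellDefined (x₀ ω) (G ω) ∧
            PlantedSparse.RoundingSucceeds θ (x₀ ω)
              (PlantedSparse.canonicalBasis (x₀ ω) (G ω)) PlantedSparse.e1 ∧
            ∀ U ∈ Matrix.orthogonalGroup (Fin (d + 1)) ℝ,
              PlantedSparse.RoundingSucceeds θ (x₀ ω)
                (PlantedSparse.canonicalBasis (x₀ ω) (G ω) * U)
                (WithLp.toLp 2 (Uᵀ *ᵥ (PlantedSparse.e1 : EuclideanSpace ℝ (Fin (d + 1))).ofLp)) := by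
  refine ⟨1 / 10 ^ 6, by norm_num, by norm_num, 2000, by norm_num, 10 ^ 6 + 48 * 500 ^ 4,
    by norm_num, ?_⟩
  intro n p d hn hnp θ hθn hθ0 Ω _ P _ x₀ G hM
  have hn1 : (1 : ℝ) ≤ n := by rw [hn]; push_cast; linarith [Nat.cast_nonneg (α := ℝ) d]
  have hdn : (d : ℝ) ≤ n := by rw [hn]; push_cast; linarith
  have hp' : (0 : ℝ) < p := by linarith
  have hp : 0 < p := by exact_mod_cast hp'
  have hθpos : 0 < θ := lt_trans (by positivity) hθn
  have hθ1 : θ < 1 := hθ0.trans (by norm_num)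
  have hsp : 0 < √(p : ℝ) := Real.sqrt_pos.2 hp'
  have hθp : √p ≤ θ * p := by
    have h1 : 1 / √(p : ℝ) ≤ θ := by
      refine le_trans ?_ hθn.le
      have hnp' : (n : ℝ) ≤ p := by linarith
      gcongr
    calc √(p : ℝ) = 1 / √p * p := by
          rw [one_div, inv_mul_eq_div, Real.div_sqrt]
      _ ≤ _ := by gcongr
  have hix : iIndepFun (fun (k : Fin p) (ω : Ω) => x₀ ω k) P :=
    hM.indep.precomp (g := Sum.inl) Sum.inl_injective
  have hiG : iIndepFun (fun (kl : Fin p × Fin d) (ω : Ω) => G ω kl.1 kl.2) P :=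
    hM.indep.precomp (g := Sum.inr) Sum.inr_injective
  let B₁ : Set Ω := {ω | ¬ PlantedSparse.IsSpread 0.55 (G ω)}
  let B₂ : Set Ω := {ω | 1.1 * (θ * p) ≤ ∑ k, √(θ * p) * x₀ ω k}
  let B₃ : Set Ω := {ω | ∑ k, √(θ * p) * x₀ ω k ≤ 0}
  let B₄ : Set Ω := {ω | ¬ ∀ k, x₀ ω k = 1 / √(θ * p) ∨ x₀ ω k = 0}
  let B : Set Ω := (B₁ ∪ B₂) ∪ (B₃ ∪ B₄)
  have hB₁ : P.real B₁ ≤ 2 * Real.exp (-(p / 500)) :=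
    PlantedSparse.gaussian_isSpread hp (by linarith) hM.law_G hiG
  obtain ⟨hB₂, hB₃⟩ := PlantedSparse.bernoulli_support_tails hθpos hθ1 hp hM.law_x₀ hix
  have hB₄ : P.real B₄ = 0 := by
    rw [measureReal_eq_zero_iff]
    exact ae_iff.1 (ae_all_iff.2 fun k => PlantedSparse.ae_scaledBernoulli (hM.law_x₀ k))
  have hexp₁ : Real.exp (-(p / 500)) ≤ 2 * 500 ^ 2 * ((p : ℝ) ^ 2)⁻¹ := by
    refine (PlantedSparse.exp_neg_le_two_div_sq (by positivity)).trans_eq ?_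
    field_simp
  have hexp₂ : Real.exp (-(θ * p / 500)) ≤ 24 * 500 ^ 4 * ((p : ℝ) ^ 2)⁻¹ := by
    have h1 : Real.exp (-(θ * p / 500)) ≤ Real.exp (-(√p / 500)) := by gcongr
    refine (h1.trans (PlantedSparse.exp_neg_le_div_pow_four (by positivity))).trans_eq ?_
    have h2 : √(p : ℝ) ^ 4 = (p : ℝ) ^ 2 := by
      rw [show 4 = 2 * 2 by norm_num, pow_mul, Real.sq_sqrt hp'.le]
    rw [div_pow, h2]
    field_simp
  have hB : P.real B ≤ (10 ^ 6 + 48 * 500 ^ 4) * ((p : ℝ) ^ 2)⁻¹ := by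
    have h1 := measureReal_union_le (μ := P) (B₁ ∪ B₂) (B₃ ∪ B₄)
    have h2 := measureReal_union_le (μ := P) B₁ B₂
    have h3 := measureReal_union_le (μ := P) B₃ B₄
    calc P.real B ≤ 2 * Real.exp (-(p / 500)) + 2 * Real.exp (-(θ * p / 500)) := by
          linarith [show P.real B₂ ≤ _ from hB₂, show P.real B₃ ≤ _ from hB₃,
            show P.real B ≤ _ from h1]
      _ ≤ 2 * (2 * 500 ^ 2 * ((p : ℝ) ^ 2)⁻¹) + 2 * (24 * 500 ^ 4 * ((p : ℝ) ^ 2)⁻¹) := by gcongr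
      _ = _ := by ring
  refine ⟨(toMeasurable P B)ᶜ, (measurableSet_toMeasurable P B).compl, ?_, fun ω hω => ?_⟩
  · rw [probReal_compl_eq_one_sub (measurableSet_toMeasurable P B), measureReal_def,
      measure_toMeasurable, ← measureReal_def]
    linarith
  · have hωB : ω ∉ B := fun h => hω (subset_toMeasurable P B h)
    simp only [B, B₁, B₂, B₃, B₄, Set.mem_union, Set.mem_ofPred_eq, not_or, not_not, not_le] at hωB
    obtain ⟨⟨h1, h2⟩, h3, h4⟩ := hωB
    obtain ⟨hwd, hround⟩ :=
      PlantedSparse.wellDefined_and_roundingSucceeds hp hθpos hθ0 h4 h2 h3 h1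
    refine ⟨hwd, ?_, hround⟩
    have := hround 1 (one_mem _)
    simpa using this
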